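/- For a complex number $q$ with $|q|<1$ put $(a;q)_n=\prod_{j=0}^{n-1}(1-aq^j)$ for $n\ge 0$, $(a;q)_\infty=\prod_{j\ge 0}(1-aq^j)$, $(q)_n=(q;q)_n$, $(q)_\infty=(q;q)_\infty$ and $(a,b,c;q)_\infty=(a;q)_\infty(b;q)_\infty(c;q)_\infty$. Then for every complex $q$ with $|q|<1$ all the double series below converge absolutely, and the following ten identities hold: $$\sum_{m,k\ge 0}\frac{q^{k^2+(m+k)^2+2(m+2k)}}{(q)_m(q)_{2k+1}}\,\frac{(-q^2;q^2)_k}{1+q^{k+1}}=\frac{(q^{20},q,q^{19};q^{20})_\infty}{(q)_\infty},\tag{1}$$ $$\sum_{m,k\ge 0}\frac{q^{k^2+(m+k)^2+2(m+2k)}(-q;q^2)_k}{(q)_m(q)_{2k+1}}=\frac{(q^{20},q^2,q^{18};q^{20})_\infty}{(q)_\infty},\tag{2}$$ $$\sum_{m,k\ge 0}\frac{q^{k^2+(m+k)^2+2(m+2k)}(1+q^{k+1})(-1;q^2)_k}{2(q)_m(q)_{2k+1}}+\sum_{m,k\ge 0}\frac{q^{k^2+(m+k)^2+2(m+2k)+k}(1+q^2)(-1;q^2)_k}{2(q)_m(q)_{2k+1}(1+q^{k+1})}=\frac{(q^{20},q^3,q^{17};q^{20})_\infty}{(q)_\infty},\tag{3}$$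 $$\sum_{m,k\ge 0}\frac{q^{k^2+(m+k)^2+(m+3k)}}{(q)_m(q)_{2k+1}}(-q;q^2)_k=\frac{(q^{20},q^4,q^{16};q^{20})_\infty}{(q)_\infty},\tag{4}$$ $$\sum_{m,k\ge 0}\frac{q^{k^2+(m+k)^2+(m+2k)}}{(q)_m(q)_{2k+1}}(-q^2;q^2)_k=\frac{(q^{20},q^5,q^{15};q^{20})_\infty}{(q)_\infty},\tag{5}$$ $$\sum_{m,k\ge 0}\frac{q^{k^2+(m+k)^2+(m+2k)}}{(q)_m(q)_{2k+1}}(-q;q^2)_k=\frac{(q^{20},q^6,q^{14};q^{20})_\infty}{(q)_\infty},\tag{6}$$ $$\sum_{m,k\ge 0}\frac{q^{k^2+(m+k)^2+(m+2k)}}{(q)_m(q)_{2k}}\,\frac{(-1;q^2)_k}{2}+(1+q)\sum_{m,k\ge 0}\frac{q^{k^2+(m+k)^2+(m+3k)}}{(q)_m(q)_{2k+1}}\,\frac{(-1;q^2)_k}{2}=\frac{(q^{20},q^7,q^{13};q^{20})_\infty}{(q)_\infty},\tag{7}$$ $$\sum_{m,k\ge 0}\frac{q^{k^2+(m+k)^2+k}}{(q)_m(q)_{2k}}\Bigl(-\frac1q;q^2\Bigr)_k=\frac{(q^{20},q^8,q^{12};q^{20})_\infty}{(q)_\infty},\tag{8}$$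 $$\sum_{m,k\ge 0}\frac{q^{k^2+(m+k)^2}}{(q)_m(q)_{2k}}\,\frac{1+q^k}{2}\,(-1;q^2)_k=\frac{(q^{20},q^9,q^{11};q^{20})_\infty}{(q)_\infty},\tag{9}$$ $$\sum_{m,k\ge 0}\frac{q^{k^2+(m+k)^2}}{(q)_m(q)_{2k}}(-q;q^2)_k=\frac{(q^{20},q^{10},q^{10};q^{20})_\infty}{(q)_\infty}.\tag{10}$$ In (8), for $q=0$ each summand is understood as its limit for $q\to0$, that is, $1$ for $m=k=0$ and $0$ otherwise. -/

import Mathlib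

/-- The finite `q`-shifted factorial `(a; q)_n = ∏_{j=0}^{n-1} (1 - a q^j)`. -/
noncomputable def qPoch (a q : ℂ) (n : ℕ) : ℂ :=
  ∏ j ∈ Finset.range n, (1 - a * q ^ j)

/-- The infinite `q`-shifted factorial `(a; q)_∞ = ∏_{j ≥ 0} (1 - a q^j)`. -/
noncomputable def qPochInf (a q : ℂ) : ℂ :=
  ∏' j : ℕ, (1 - a * q ^ j)

/-- The product defining `(a; q)_∞` converges for `|q| < 1`, so that `qPochInf` is the
genuine value of the infinite product. -/
theorem multipliable_qPochInf (a q : ℂ) (hq : ‖q‖ < 1) :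
    Multipliable (fun j : ℕ => 1 - a * q ^ j) := by
  have h : Summable (fun j : ℕ => ‖-(a * q ^ j)‖) := by
    simp only [norm_neg, norm_mul, norm_pow]
    exact (summable_geometric_of_lt_one (norm_nonneg q) hq).mul_left _
  simpa [sub_eq_add_neg] using multipliable_one_add_of_summable h

/-- `(a, b, c; q)_∞ = (a; q)_∞ (b; q)_∞ (c; q)_∞`. -/
noncomputable def qPochInf₃ (a b c q : ℂ) : ℂ :=
  qPochInf a q * qPochInf b q * qPochInf c q

/-!
The ten identities are instances of one double series. For an integer `b` let
`α_s = (-1)^s q^{2s²+bs}` and, for `a ∈ {0, 1, 2}`,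
`β_k = ∑_{s ∈ ℤ} α_s / ((q)_{k-2s} (q)_{k+2s+a})`; this is a Bailey pair relative to `q^a` whose
`α`-side lives on the even indices. Bailey's lemma (`tsum_mul_baileySum`), which is the
`q`-Vandermonde summation `tsum_qVandermonde` applied termwise, says that summing `β_k` against
`q^{k²+ak} / (q)_{n-k}` multiplies `α_s` by `q^{4s²+2as}`. Applying it once as it stands and once in
the limit `n → ∞` (`tsum_zpow_mul_baileySum`) gives
`∑_{m,k} q^{k²+ak+(m+k)²+a(m+k)} β_k / (q)_m = (q)_∞⁻¹ ∑_s (-1)^s q^{10s²+(b+4a)s}`,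
and the theta series on the right is a product by Jacobi's triple product identity, proved in
`jacobi_triple_product` from its finite form. The outcome is `hasSum_altGauss`; the exponent
`10 - b - 4a` runs through `1, …, 10`.

It remains to evaluate `β_k`, that is, the alternating sums of Gaussian binomial coefficients
`altGauss q N b k = ∑_s (-1)^s q^{2s²+bs} [N, k-2s]` with `N = 2k + a`. The two Pascal rules, the
symmetry of the binomial coefficients and the shift `s ↦ s + 1` connect the three families
`a = 0, 1, 2` by recurrences that determine the closed forms for `-1 ≤ b ≤ 2` by induction on `k`.
In two of the identities the combined series on the left corresponds to one `β_k`.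

Reciprocals `1 / (q)_n` are extended by `0` to negative `n`, so that all sums over `s` and `k` can be
taken over `ℤ` and shifted freely. Negative powers of `q` then occur, so `q = 0` is treated apart.
-/

/-! ### Shifted factorials and their reciprocals -/

theorem qPoch_succ (a q : ℂ) (n : ℕ) :
    qPoch a q (n + 1) = qPoch a q n * (1 - a * q ^ n) := by
  simp [qPoch, Finset.prod_range_succ]

theorem qPoch_succ' (a q : ℂ) (n : ℕ) :
    qPoch a q (n + 1) = (1 - a) * qPoch (a * q) q n := by
  simp only [qPoch, Finset.prod_range_succ', pow_zero, mul_one, pow_succ']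
  rw [mul_comm]
  simp only [mul_assoc]

@[simp] theorem qPoch_zero (a q : ℂ) : qPoch a q 0 = 1 := by simp [qPoch]

theorem one_sub_pow_ne_zero {q : ℂ} (hq : ‖q‖ < 1) {n : ℕ} (hn : n ≠ 0) : 1 - q ^ n ≠ 0 := by
  intro h
  have h1 : ‖q ^ n‖ = 1 := by rw [← sub_eq_zero.mp h]; simp
  rw [norm_pow] at h1
  exact (pow_lt_one₀ (norm_nonneg q) hq hn).ne h1

theorem one_add_pow_ne_zero {q : ℂ} (hq : ‖q‖ < 1) {n : ℕ} (hn : n ≠ 0) : 1 + q ^ n ≠ 0 := by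
  intro h
  have h1 : ‖q ^ n‖ = 1 := by rw [← neg_eq_of_add_eq_zero_right h]; simp
  rw [norm_pow] at h1
  exact (pow_lt_one₀ (norm_nonneg q) hq hn).ne h1

theorem qPoch_self_ne_zero {q : ℂ} (hq : ‖q‖ < 1) (n : ℕ) : qPoch q q n ≠ 0 := by
  refine Finset.prod_ne_zero_iff.mpr fun j _ => ?_
  rw [← pow_succ']
  exact one_sub_pow_ne_zero hq j.succ_ne_zero

/-- The reciprocal `1 / (q; q)_n` for an integer index `n`, with the customary value `0` for
negative `n`, so that sums over `ℤ` terminate by themselves. -/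
noncomputable def qFactInv (q : ℂ) (n : ℤ) : ℂ :=
  if 0 ≤ n then (qPoch q q n.toNat)⁻¹ else 0

@[simp] theorem qFactInv_natCast (q : ℂ) (n : ℕ) : qFactInv q n = (qPoch q q n)⁻¹ := by
  simp [qFactInv]

@[simp] theorem qFactInv_zero (q : ℂ) : qFactInv q 0 = 1 := by
  simp [qFactInv]

theorem qFactInv_of_neg (q : ℂ) {n : ℤ} (hn : n < 0) : qFactInv q n = 0 := by
  simp [qFactInv, hn]

theorem nonneg_of_qFactInv_ne_zero {q : ℂ} {n : ℤ} (h : qFactInv q n ≠ 0) : 0 ≤ n := by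
  by_contra! hn
  exact h (qFactInv_of_neg q hn)

/-- The recurrence `(q)_n = (q)_{n-1} (1 - q^n)` for reciprocals; with the convention for negative
indices it holds for every integer. -/
theorem qFactInv_sub_one {q : ℂ} (hq : ‖q‖ < 1) (n : ℤ) :
    qFactInv q (n - 1) = (1 - q ^ n) * qFactInv q n := by
  rcases lt_trichotomy n 0 with h | rfl | h
  · rw [qFactInv_of_neg q h, qFactInv_of_neg q (by omega), mul_zero]
  · simp [qFactInv]
  · obtain ⟨m, rfl⟩ : ∃ m : ℕ, n = (m + 1 : ℕ) := ⟨(n - 1).toNat, by omega⟩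
    have e : ((m + 1 : ℕ) : ℤ) - 1 = (m : ℕ) := by push_cast; ring
    rw [e, qFactInv_natCast, qFactInv_natCast, zpow_natCast, qPoch_succ, ← pow_succ']
    have h1 := one_sub_pow_ne_zero hq m.succ_ne_zero
    have h2 := qPoch_self_ne_zero hq m
    field_simp

theorem summable_of_ne_zero_bounded {f : ℤ → ℂ} (A B : ℤ)
    (h : ∀ s, f s ≠ 0 → A ≤ s ∧ s ≤ B) : Summable f :=
  summable_of_hasFiniteSupport ((Set.finite_Icc A B).subset fun s hs => h s hs)

theorem summable_mul_qFactInv (q : ℂ) (f : ℤ → ℂ) (x y : ℤ) :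
    Summable fun s : ℤ => f s * qFactInv q (x - s) * qFactInv q (y + s) := by
  refine summable_of_ne_zero_bounded (-y) x fun s hs => ?_
  have h1 := nonneg_of_qFactInv_ne_zero (right_ne_zero_of_mul (left_ne_zero_of_mul hs))
  have h2 := nonneg_of_qFactInv_ne_zero (right_ne_zero_of_mul hs)
  omega

theorem summable_mul_qFactInv_two (q : ℂ) (f : ℤ → ℂ) (x y : ℤ) :
    Summable fun s : ℤ => f s * qFactInv q (x - 2 * s) * qFactInv q (y + 2 * s) := by
  refine summable_of_ne_zero_bounded (-|y|) |x| fun s hs => ?_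
  have h1 := nonneg_of_qFactInv_ne_zero (right_ne_zero_of_mul (left_ne_zero_of_mul hs))
  have h2 := nonneg_of_qFactInv_ne_zero (right_ne_zero_of_mul hs)
  have := le_abs_self x
  have := le_abs_self y
  have := abs_nonneg x
  have := abs_nonneg y
  omega

/-! ### Alternating sums of Gaussian binomial coefficients -/

/-- The sum `∑_s α_s / ((q)_{x-2s} (q)_{y+2s})` over all integers `s`. For `x = k`, `y = k + a` it is
the `β`-side of a Bailey pair relative to `q ^ a` whose `α`-side is supported on even indices. -/
noncomputable def baileySum (q : ℂ) (α : ℤ → ℂ) (x y : ℤ) : ℂ :=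
  ∑' s : ℤ, α s * qFactInv q (x - 2 * s) * qFactInv q (y + 2 * s)

/-- The coefficients `(-1)^s q^{2s²+bs}` of a theta series. -/
noncomputable def thetaCoeff (q : ℂ) (b s : ℤ) : ℂ :=
  (-1) ^ s * q ^ (2 * s ^ 2 + b * s)

/-- The alternating sum `∑_s (-1)^s q^{2s²+bs} [N, x-2s]_q` of Gaussian binomial coefficients. -/
noncomputable def altGauss (q : ℂ) (N : ℕ) (b x : ℤ) : ℂ :=
  qPoch q q N * baileySum q (thetaCoeff q b) x (N - x)

theorem neg_one_zpow_neg (s : ℤ) : (-1 : ℂ) ^ (-s) = (-1) ^ s := by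
  rw [zpow_neg, ← inv_zpow]; norm_num

theorem altGauss_pascal_left {q : ℂ} (h0 : q ≠ 0) (hq : ‖q‖ < 1) (N : ℕ) (b x : ℤ) :
    altGauss q (N + 1) b x = altGauss q N b (x - 1) + q ^ x * altGauss q N (b - 2) x := by
  have key : (1 - q ^ (N + 1)) * baileySum q (thetaCoeff q b) x ((N + 1 : ℕ) - x) =
      baileySum q (thetaCoeff q b) (x - 1) (N - (x - 1)) +
        q ^ x * baileySum q (thetaCoeff q (b - 2)) x (N - x) := by
    simp only [baileySum]
    rw [← tsum_mul_left, ← tsum_mul_left, ← (summable_mul_qFactInv_two q _ _ _).tsum_add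
      ((summable_mul_qFactInv_two q _ _ _).mul_left _)]
    refine tsum_congr fun s => ?_
    have h1 := qFactInv_sub_one hq (x - 2 * s)
    have h2 := qFactInv_sub_one hq ((N + 1 : ℕ) - x + 2 * s)
    rw [show x - 1 - 2 * s = x - 2 * s - 1 by ring,
      show (N : ℤ) - (x - 1) + 2 * s = (N + 1 : ℕ) - x + 2 * s by push_cast; ring,
      show (N : ℤ) - x + 2 * s = (N + 1 : ℕ) - x + 2 * s - 1 by push_cast; ring, h1, h2]
    have e1 : q ^ (N + 1) = q ^ (x - 2 * s) * q ^ (((N + 1 : ℕ) : ℤ) - x + 2 * s) := by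
      rw [← zpow_add₀ h0, ← zpow_natCast]; congr 1; ring
    have e2 : q ^ x * thetaCoeff q (b - 2) s = q ^ (x - 2 * s) * thetaCoeff q b s := by
      simp only [thetaCoeff]
      rw [mul_left_comm, mul_left_comm (q ^ (x - 2 * s)), ← zpow_add₀ h0, ← zpow_add₀ h0]
      ring_nf
    rw [e1]
    linear_combination (-(1 - q ^ (((N + 1 : ℕ) : ℤ) - x + 2 * s)) * qFactInv q (x - 2 * s) *
      qFactInv q ((N + 1 : ℕ) - x + 2 * s)) * e2
  simp only [altGauss]
  rw [qPoch_succ, ← pow_succ', mul_assoc, key]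
  ring

theorem altGauss_reflect {q : ℂ} (N : ℕ) (b x : ℤ) :
    altGauss q N b x = altGauss q N (-b) (N - x) := by
  simp only [altGauss, baileySum]
  congr 1
  rw [← (Equiv.neg ℤ).tsum_eq]
  refine tsum_congr fun s => ?_
  simp only [thetaCoeff, Equiv.neg_apply, neg_one_zpow_neg]
  rw [mul_right_comm]
  ring_nf

theorem altGauss_shift {q : ℂ} (h0 : q ≠ 0) (N : ℕ) (b x : ℤ) :
    altGauss q N b x = -q ^ (2 + b) * altGauss q N (b + 4) (x - 2) := by
  simp only [altGauss, baileySum]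
  rw [mul_left_comm]
  congr 1
  rw [← (Equiv.addRight (1 : ℤ)).tsum_eq, ← tsum_mul_left]
  refine tsum_congr fun s => ?_
  simp only [thetaCoeff, Equiv.coe_addRight]
  rw [show x - 2 * (s + 1) = x - 2 - 2 * s by ring,
    show (N : ℤ) - x + 2 * (s + 1) = N - (x - 2) + 2 * s by ring, zpow_add_one₀ (by norm_num),
    show 2 * (s + 1) ^ 2 + b * (s + 1) = (2 + b) + (2 * s ^ 2 + (b + 4) * s) by ring,
    zpow_add₀ h0]
  ring

theorem altGauss_pascal_right {q : ℂ} (h0 : q ≠ 0) (hq : ‖q‖ < 1) (N : ℕ) (b x : ℤ) :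
    altGauss q (N + 1) b x =
      altGauss q N b x + q ^ ((N : ℤ) + 1 - x) * altGauss q N (b + 2) (x - 1) := by
  rw [altGauss_reflect, altGauss_pascal_left h0 hq, altGauss_reflect N b x,
    altGauss_reflect N (b + 2) (x - 1)]
  push_cast
  ring_nf

theorem altGauss_zero (q : ℂ) (b : ℤ) : altGauss q 0 b 0 = 1 := by
  simp only [altGauss, baileySum]
  rw [tsum_eq_single 0]
  · simp [thetaCoeff]
  · intro s hs
    rcases lt_or_gt_of_ne hs with h | h
    · rw [qFactInv_of_neg q (n := _ + 2 * s) (by push_cast; omega), mul_zero]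
    · rw [qFactInv_of_neg q (n := _ - 2 * s) (by omega), mul_zero, zero_mul]

theorem altGauss_zero_neg_one (q : ℂ) (b : ℤ) : altGauss q 0 b (-1) = 0 := by
  simp only [altGauss, baileySum]
  convert mul_zero _
  convert tsum_zero with s
  rcases le_or_gt 0 s with h | h
  · rw [qFactInv_of_neg q (n := _ - 2 * s) (by omega), mul_zero, zero_mul]
  · rw [qFactInv_of_neg q (n := _ + 2 * s) (by push_cast; omega), mul_zero]

/-! ### Closed forms of the central sums -/

/-- The first of the recurrences connecting the central families `altGauss q (2k) b k`,
`altGauss q (2k+1) b k` and `altGauss q (2k+2) b k`. -/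
theorem altGauss_even_succ {q : ℂ} (h0 : q ≠ 0) (hq : ‖q‖ < 1) (k : ℕ) (b : ℤ) :
    altGauss q (2 * (k + 1)) b (k + 1 : ℕ) =
      altGauss q (2 * k + 1) b k + q ^ (k + 1) * altGauss q (2 * k + 1) (2 - b) k := by
  rw [show 2 * (k + 1) = 2 * k + 1 + 1 by ring, altGauss_pascal_left h0 hq, zpow_natCast,
    altGauss_reflect _ (b - 2)]
  push_cast
  ring_nf

theorem altGauss_odd_succ_left {q : ℂ} (h0 : q ≠ 0) (hq : ‖q‖ < 1) (k : ℕ) (b : ℤ) :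
    altGauss q (2 * (k + 1) + 1) b (k + 1 : ℕ) = altGauss q (2 * k + 2) b k +
      q ^ (k + 1) * altGauss q (2 * (k + 1)) (b - 2) (k + 1 : ℕ) := by
  rw [altGauss_pascal_left h0 hq, zpow_natCast]
  push_cast
  ring_nf

theorem altGauss_odd_succ_right {q : ℂ} (h0 : q ≠ 0) (hq : ‖q‖ < 1) (k : ℕ) (b : ℤ) :
    altGauss q (2 * (k + 1) + 1) b (k + 1 : ℕ) = altGauss q (2 * (k + 1)) b (k + 1 : ℕ) +
      q ^ (k + 2) * altGauss q (2 * k + 2) (b + 2) k := by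
  rw [altGauss_pascal_right h0 hq, ← zpow_natCast]
  push_cast
  ring_nf

theorem altGauss_even_neg (q : ℂ) (k : ℕ) (b : ℤ) :
    altGauss q (2 * k) (-b) k = altGauss q (2 * k) b k := by
  rw [altGauss_reflect]
  push_cast
  ring_nf

theorem altGauss_offset_symm {q : ℂ} (h0 : q ≠ 0) (k : ℕ) (b : ℤ) :
    altGauss q (2 * k + 2) b k = -q ^ (2 - b) * altGauss q (2 * k + 2) (4 - b) k := by
  rw [altGauss_reflect, altGauss_shift h0]
  push_cast
  ring_nf

/-- The value `b = 2` is the fixed point of the symmetry of the third family, where that symmetry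
changes the sign. This starts the evaluation of the closed forms. -/
theorem altGauss_offset_two {q : ℂ} (h0 : q ≠ 0) (k : ℕ) : altGauss q (2 * k + 2) 2 k = 0 := by
  have h := altGauss_offset_symm h0 k 2
  norm_num at h
  linear_combination h / 2

theorem altGauss_odd_zero_two {q : ℂ} (h0 : q ≠ 0) (hq : ‖q‖ < 1) (k : ℕ) :
    altGauss q (2 * k + 1) 0 k = qPoch (-q) (q ^ 2) k ∧
      altGauss q (2 * k + 1) 2 k = q ^ k * qPoch (-q) (q ^ 2) k := by
  induction k with
  | zero =>
    constructor <;> · simp [altGauss_pascal_right h0 hq, altGauss_zero, altGauss_zero_neg_one]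
  | succ k ih =>
    have e := altGauss_even_succ h0 hq k 0
    have o0 := altGauss_odd_succ_right h0 hq k 0
    have o2 := altGauss_odd_succ_left h0 hq k 2
    have t := altGauss_offset_two h0 k
    norm_num only at e o0 o2
    rw [ih.1, ih.2] at e
    rw [t] at o0 o2
    rw [qPoch_succ, o0, o2, e]
    constructor <;> ring

theorem altGauss_even_zero {q : ℂ} (h0 : q ≠ 0) (hq : ‖q‖ < 1) (k : ℕ) :
    altGauss q (2 * k) 0 k = qPoch (-q) (q ^ 2) k := by
  cases k with
  | zero => simp [altGauss_zero]
  | succ k =>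
    have e := altGauss_even_succ h0 hq k 0
    norm_num only at e
    rw [e, qPoch_succ, (altGauss_odd_zero_two h0 hq k).1, (altGauss_odd_zero_two h0 hq k).2]
    ring

theorem altGauss_even_two {q : ℂ} (h0 : q ≠ 0) (hq : ‖q‖ < 1) (k : ℕ) :
    altGauss q (2 * k) 2 k = q ^ k * qPoch (-(1 / q)) (q ^ 2) k := by
  cases k with
  | zero => simp [altGauss_zero]
  | succ k =>
    have e := altGauss_even_succ h0 hq k 2
    norm_num only at e
    rw [e, qPoch_succ', (altGauss_odd_zero_two h0 hq k).1, (altGauss_odd_zero_two h0 hq k).2,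
      show -(1 / q) * q ^ 2 = -q by field_simp]
    field_simp
    ring

theorem altGauss_offset_zero {q : ℂ} (h0 : q ≠ 0) (hq : ‖q‖ < 1) (k : ℕ) :
    altGauss q (2 * k + 2) 0 k = (1 - q ^ (2 * k + 2)) * qPoch (-q) (q ^ 2) k := by
  have e := altGauss_even_succ h0 hq k 2
  have o := altGauss_odd_succ_left h0 hq k 0
  have n := altGauss_even_neg q (k + 1) 2
  have o' := (altGauss_odd_zero_two h0 hq (k + 1)).1
  norm_num only at e o n
  rw [(altGauss_odd_zero_two h0 hq k).1, (altGauss_odd_zero_two h0 hq k).2] at e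
  rw [n, e, o', qPoch_succ] at o
  linear_combination -o

theorem altGauss_odd_one {q : ℂ} (h0 : q ≠ 0) (hq : ‖q‖ < 1) (k : ℕ) :
    altGauss q (2 * k + 1) 1 k = qPoch (-q ^ 2) (q ^ 2) k := by
  induction k with
  | zero => simp [altGauss_pascal_right h0 hq, altGauss_zero, altGauss_zero_neg_one]
  | succ k ih =>
    have e := altGauss_even_succ h0 hq k 1
    have oR := altGauss_odd_succ_right h0 hq k 1
    have oL := altGauss_odd_succ_left h0 hq k 1
    have t := altGauss_offset_symm h0 k 1
    have n := altGauss_even_neg q (k + 1) 1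
    norm_num only at e oR oL t n
    rw [ih] at e
    rw [n] at oL
    have hne := one_add_pow_ne_zero hq k.succ_ne_zero
    rw [Nat.succ_eq_add_one] at hne
    rw [zpow_one] at t
    refine mul_left_cancel₀ hne ?_
    rw [qPoch_succ]
    -- Eliminating the third family from the two recurrences for odd `N` yields
    -- `(1 + q^(k+1)) o_{k+1} = (1 + q^(2k+2)) e_{k+1}`, and `e_{k+1} = (1 + q^(k+1)) o_k`.
    linear_combination oR + q ^ (k + 1) * oL + q ^ (k + 1) * t + (1 + q ^ (2 * (k + 1))) * e

theorem altGauss_even_one_succ {q : ℂ} (h0 : q ≠ 0) (hq : ‖q‖ < 1) (k : ℕ) :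
    altGauss q (2 * (k + 1)) 1 (k + 1 : ℕ) = (1 + q ^ (k + 1)) * qPoch (-q ^ 2) (q ^ 2) k := by
  have e := altGauss_even_succ h0 hq k 1
  norm_num only at e
  rw [e, altGauss_odd_one h0 hq]
  ring

theorem qPoch_neg_one_succ (q : ℂ) (k : ℕ) :
    qPoch (-1) q (k + 1) = 2 * qPoch (-q) q k := by
  rw [qPoch_succ']; norm_num

theorem altGauss_even_one {q : ℂ} (h0 : q ≠ 0) (hq : ‖q‖ < 1) (k : ℕ) :
    altGauss q (2 * k) 1 k = (1 + q ^ k) / 2 * qPoch (-1) (q ^ 2) k := by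
  cases k with
  | zero => simp [altGauss_zero]
  | succ k =>
    rw [altGauss_even_one_succ h0 hq, qPoch_neg_one_succ]
    ring

theorem altGauss_offset_one {q : ℂ} (h0 : q ≠ 0) (hq : ‖q‖ < 1) (k : ℕ) :
    altGauss q (2 * k + 2) 1 k = (1 - q ^ (k + 1)) * qPoch (-q ^ 2) (q ^ 2) k := by
  have oL := altGauss_odd_succ_left h0 hq k 1
  have n := altGauss_even_neg q (k + 1) 1
  norm_num only at oL n
  rw [n, altGauss_odd_one h0 hq, altGauss_even_one_succ h0 hq, qPoch_succ] at oL
  linear_combination -oL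

theorem altGauss_odd_neg_one_succ {q : ℂ} (h0 : q ≠ 0) (hq : ‖q‖ < 1) (k : ℕ) :
    altGauss q (2 * (k + 1) + 1) (-1) (k + 1 : ℕ) =
      (1 + q ^ (k + 1) + q ^ (k + 2) * (1 - q ^ (k + 1))) * qPoch (-q ^ 2) (q ^ 2) k := by
  have o := altGauss_odd_succ_right h0 hq k (-1)
  have n := altGauss_even_neg q (k + 1) 1
  norm_num only at o n
  rw [o, n, altGauss_offset_one h0 hq, altGauss_even_one_succ h0 hq]
  ring

theorem altGauss_odd_neg_one {q : ℂ} (h0 : q ≠ 0) (hq : ‖q‖ < 1) (k : ℕ) :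
    altGauss q (2 * k + 1) (-1) k =
      (1 + q ^ k + q ^ (k + 1) - q ^ (2 * k + 1)) * (qPoch (-1) (q ^ 2) k / 2) := by
  cases k with
  | zero => simp [altGauss_pascal_right h0 hq, altGauss_zero, altGauss_zero_neg_one]; norm_num
  | succ k =>
    rw [altGauss_odd_neg_one_succ h0 hq, qPoch_neg_one_succ]
    ring

theorem altGauss_offset_neg_one {q : ℂ} (h0 : q ≠ 0) (hq : ‖q‖ < 1) (k : ℕ) :
    altGauss q (2 * k + 2) (-1) k = (1 - q ^ (k + 1)) * (qPoch (-1) (q ^ 2) k / 2) *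
      ((1 + q ^ (k + 1)) ^ 2 + q ^ k * (1 + q ^ 2)) := by
  have o := altGauss_odd_succ_left h0 hq k (-1)
  have n3 := altGauss_even_neg q (k + 1) 3
  have n1 := altGauss_even_neg q (k + 1) 1
  have e3 := altGauss_even_succ h0 hq k 3
  have e1 := altGauss_even_succ h0 hq k (-1)
  have p := qPoch_neg_one_succ (q ^ 2) k
  rw [qPoch_succ] at p
  norm_num only at o n3 n1 e3 e1
  rw [n1, altGauss_even_one_succ h0 hq, altGauss_odd_neg_one h0 hq] at e1
  rw [altGauss_odd_neg_one h0 hq] at e3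
  rw [altGauss_odd_neg_one_succ h0 hq, n3, e3] at o
  linear_combination -o + e1 - q ^ (k + 2) * (1 - q ^ (k + 1)) / 2 * p

/-! ### The Bailey transform -/

/-- Pascal's rule for the symmetric form `1 / ((q)_x (q)_y)`, from the splitting
`1 - q^{x+y} = (1 - q^x) + q^x (1 - q^y)`. -/
theorem mul_qFactInv_mul_qFactInv {q : ℂ} (h0 : q ≠ 0) (hq : ‖q‖ < 1) (x y : ℤ) :
    (1 - q ^ (x + y)) * (qFactInv q x * qFactInv q y) =
      qFactInv q (x - 1) * qFactInv q y + q ^ x * (qFactInv q x * qFactInv q (y - 1)) := by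
  rw [qFactInv_sub_one hq, qFactInv_sub_one hq, zpow_add₀ h0]
  ring

/-- The `q`-Vandermonde summation, as a sum over all integers and valid for every integer `M`
and `L`. -/
theorem tsum_qVandermonde {q : ℂ} (h0 : q ≠ 0) (hq : ‖q‖ < 1) (M L : ℤ) :
    ∑' j : ℤ, q ^ (j * (j + L)) * qFactInv q (j + L) * qFactInv q (M - j) * qFactInv q j =
      qFactInv q M * qFactInv q (M + L) := by
  rcases lt_or_ge M 0 with hM | hM
  · rw [qFactInv_of_neg q hM, zero_mul]
    convert tsum_zero with j
    rcases le_or_gt 0 j with h | h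
    · rw [qFactInv_of_neg q (n := M - j) (by omega), mul_zero, zero_mul]
    · rw [qFactInv_of_neg q h, mul_zero]
  obtain ⟨m, rfl⟩ := Int.eq_ofNat_of_zero_le hM
  clear hM
  induction m generalizing L with
  | zero =>
    rw [tsum_eq_single 0]
    · simp
    · intro j hj
      rcases lt_or_gt_of_ne hj with h | h
      · rw [qFactInv_of_neg q h, mul_zero]
      · rw [qFactInv_of_neg q (n := _ - j) (by push_cast; omega), mul_zero, zero_mul]
  | succ m ih =>
    have hne : (1 : ℂ) - q ^ ((m + 1 : ℕ) : ℤ) ≠ 0 := by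
      rw [zpow_natCast]; exact one_sub_pow_ne_zero hq m.succ_ne_zero
    refine mul_left_cancel₀ hne ?_
    have hs (L' : ℤ) : Summable fun j : ℤ =>
        q ^ (j * (j + L')) * qFactInv q (j + L') * qFactInv q ((m : ℤ) - j) * qFactInv q j := by
      simpa using summable_mul_qFactInv q (fun j => q ^ (j * (j + L')) * qFactInv q (j + L')) m 0
    -- Splitting `1 - q^(m+1)` over the two factors `1/(q)_{m+1-j}` and `1/(q)_j` lowers `m`; in the
    -- second part `j` is shifted by one, which raises `L`.
    have key : (1 - q ^ ((m + 1 : ℕ) : ℤ)) * ∑' j : ℤ, q ^ (j * (j + L)) * qFactInv q (j + L) *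
          qFactInv q ((m + 1 : ℕ) - j) * qFactInv q j =
        (∑' j : ℤ, q ^ (j * (j + L)) * qFactInv q (j + L) * qFactInv q ((m : ℤ) - j) *
          qFactInv q j) + q ^ ((m + 1 : ℕ) + L) * ∑' j : ℤ, q ^ (j * (j + (L + 1))) *
          qFactInv q (j + (L + 1)) * qFactInv q ((m : ℤ) - j) * qFactInv q j := by
      have e2 : q ^ ((m + 1 : ℕ) + L) * ∑' j : ℤ, q ^ (j * (j + (L + 1))) *
          qFactInv q (j + (L + 1)) * qFactInv q ((m : ℤ) - j) * qFactInv q j =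
          ∑' j : ℤ, q ^ (j * (j + L) + ((m + 1 : ℕ) - j)) * qFactInv q (j + L) *
            qFactInv q ((m + 1 : ℕ) - j) * qFactInv q (j - 1) := by
        rw [← tsum_mul_left, ← (Equiv.addRight (1 : ℤ)).tsum_eq (fun j : ℤ =>
          q ^ (j * (j + L) + ((m + 1 : ℕ) - j)) * qFactInv q (j + L) *
            qFactInv q ((m + 1 : ℕ) - j) * qFactInv q (j - 1))]
        refine tsum_congr fun j => ?_
        simp only [Equiv.coe_addRight]
        rw [show j + 1 + L = j + (L + 1) by ring, show ((m + 1 : ℕ) : ℤ) - (j + 1) = m - j by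
          push_cast; ring, show j + 1 - 1 = j by ring, ← mul_assoc, ← mul_assoc, ← mul_assoc,
          ← zpow_add₀ h0]
        push_cast
        ring_nf
      rw [e2, ← tsum_mul_left, ← (hs L).tsum_add]
      · refine tsum_congr fun j => ?_
        have h := mul_qFactInv_mul_qFactInv h0 hq ((m + 1 : ℕ) - j) j
        rw [sub_add_cancel, show ((m + 1 : ℕ) : ℤ) - j - 1 = m - j by push_cast; ring] at h
        rw [zpow_add₀ h0]
        linear_combination q ^ (j * (j + L)) * qFactInv q (j + L) * h
      · refine summable_of_ne_zero_bounded 0 (m + 1 : ℕ) fun j hj => ?_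
        have h1 := nonneg_of_qFactInv_ne_zero (right_ne_zero_of_mul (left_ne_zero_of_mul hj))
        have h2 := nonneg_of_qFactInv_ne_zero (right_ne_zero_of_mul hj)
        omega
    rw [key, ih L, ih (L + 1)]
    have h1 := qFactInv_sub_one hq (m + 1 : ℕ)
    have h2 := qFactInv_sub_one hq ((m + 1 : ℕ) + L)
    rw [show ((m + 1 : ℕ) : ℤ) - 1 = m by push_cast; ring] at h1
    rw [show ((m + 1 : ℕ) : ℤ) + L - 1 = m + L by push_cast; ring] at h2
    rw [h2, show (m : ℤ) + (L + 1) = (m + 1 : ℕ) + L by push_cast; ring]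
    linear_combination qFactInv q ((m + 1 : ℕ) + L) * h1

/-- The `q`-Vandermonde summation in the form used in the Bailey transform: a term with index `r`
of the `α`-side contributes `q^{r²+ar}` times itself to the next pair. -/
theorem tsum_qVandermonde_bilateral {q : ℂ} (h0 : q ≠ 0) (hq : ‖q‖ < 1) (a n r : ℤ) :
    ∑' k : ℤ, q ^ (k ^ 2 + a * k) * qFactInv q (n - k) * (qFactInv q (k - r) *
        qFactInv q (k + a + r)) =
      q ^ (r ^ 2 + a * r) * (qFactInv q (n - r) * qFactInv q (n + a + r)) := by
  have h := tsum_qVandermonde h0 hq (n - r) (2 * r + a)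
  rw [show n - r + (2 * r + a) = n + a + r by ring] at h
  rw [← h, ← tsum_mul_left, ← (Equiv.addRight r).tsum_eq]
  refine tsum_congr fun j => ?_
  simp only [Equiv.coe_addRight]
  rw [show (j + r) ^ 2 + a * (j + r) = (r ^ 2 + a * r) + j * (j + (2 * r + a)) by ring,
    zpow_add₀ h0]
  ring_nf

theorem summable_baileySum_terms (q : ℂ) (α : ℤ → ℂ) (c : ℤ → ℂ) (a n : ℤ) :
    Summable (Function.uncurry fun k s : ℤ => c k * qFactInv q (n - k) *
      (α s * qFactInv q (k - 2 * s) * qFactInv q (k + a + 2 * s))) := by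
  have hfin : (Set.Icc (-|a|) |n| ×ˢ Set.Icc (-|n| - |a|) |n|).Finite :=
    (Set.finite_Icc _ _).prod (Set.finite_Icc _ _)
  refine summable_of_hasFiniteSupport (hfin.subset ?_)
  rintro ⟨k, s⟩ h
  rw [Function.mem_support, Function.uncurry_apply_pair] at h
  have h1 := nonneg_of_qFactInv_ne_zero (right_ne_zero_of_mul (left_ne_zero_of_mul h))
  have h2 := nonneg_of_qFactInv_ne_zero (right_ne_zero_of_mul (left_ne_zero_of_mul
    (right_ne_zero_of_mul h)))
  have h3 := nonneg_of_qFactInv_ne_zero (right_ne_zero_of_mul (right_ne_zero_of_mul h))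
  clear h hfin
  rw [Set.mem_prod, Set.mem_Icc, Set.mem_Icc]
  have := le_abs_self n
  have := le_abs_self a
  have := abs_nonneg a
  have := abs_nonneg n
  refine ⟨⟨?_, ?_⟩, ?_, ?_⟩ <;> dsimp only <;> linarith

/-- Bailey's lemma (in the limiting case where both parameters tend to infinity): summing a
`β`-side against `q^{k²+ak} / (q)_{n-k}` gives another `β`-side. -/
theorem tsum_mul_baileySum {q : ℂ} (h0 : q ≠ 0) (hq : ‖q‖ < 1) (α : ℤ → ℂ) (a n : ℤ) :
    ∑' k : ℤ, q ^ (k ^ 2 + a * k) * qFactInv q (n - k) * baileySum q α k (k + a) =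
      baileySum q (fun s => q ^ (4 * s ^ 2 + 2 * a * s) * α s) n (n + a) := by
  have hs := summable_baileySum_terms q α (fun k => q ^ (k ^ 2 + a * k)) a n
  simp only [baileySum, ← tsum_mul_left]
  rw [← hs.tsum_comm]
  refine tsum_congr fun s => ?_
  have h := tsum_qVandermonde_bilateral h0 hq a n (2 * s)
  rw [show (2 * s) ^ 2 + a * (2 * s) = 4 * s ^ 2 + 2 * a * s by ring] at h
  calc _ = α s * ∑' k : ℤ, q ^ (k ^ 2 + a * k) * qFactInv q (n - k) *
        (qFactInv q (k - 2 * s) * qFactInv q (k + a + 2 * s)) := by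
        rw [← tsum_mul_left]
        exact tsum_congr fun k => by ring
    _ = _ := by rw [h]; ring

/-! ### The Jacobi triple product -/

/-- The series `∑_s (-1)^s w^s p^{s²} / ((Q)_{x-s} (Q)_{y+s})` with `Q = p²`, a finite form of the
bilateral series in Jacobi's triple product. Writing the base as a square avoids half-integral
exponents. -/
noncomputable def finiteTheta (p w : ℂ) (x y : ℤ) : ℂ :=
  ∑' s : ℤ, (-1) ^ s * w ^ s * p ^ (s ^ 2) * qFactInv (p ^ 2) (x - s) * qFactInv (p ^ 2) (y + s)

theorem finiteTheta_shift {p w : ℂ} (hp : p ≠ 0) (hw : w ≠ 0) (x y : ℤ) :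
    finiteTheta p w x y = -(w * p) * finiteTheta p (w * p ^ 2) (x - 1) (y + 1) := by
  simp only [finiteTheta]
  rw [← (Equiv.addRight (1 : ℤ)).tsum_eq, ← tsum_mul_left]
  refine tsum_congr fun s => ?_
  simp only [Equiv.coe_addRight]
  rw [show x - (s + 1) = x - 1 - s by ring, show y + (s + 1) = y + 1 + s by ring,
    zpow_add_one₀ (by norm_num), zpow_add_one₀ hw, mul_zpow,
    show (s + 1) ^ 2 = s ^ 2 + 2 * s + 1 by ring, zpow_add_one₀ hp, zpow_add₀ hp, zpow_mul,
    zpow_ofNat]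
  ring

theorem finiteTheta_reflect (p w : ℂ) (x y : ℤ) :
    finiteTheta p w x y = finiteTheta p w⁻¹ y x := by
  simp only [finiteTheta]
  rw [← (Equiv.neg ℤ).tsum_eq]
  refine tsum_congr fun s => ?_
  simp only [Equiv.neg_apply, neg_one_zpow_neg, inv_zpow', neg_sq]
  ring_nf

/-- Lowering `x` by one extracts one factor of the product: the recurrence for `1 / (Q)_n` leaves a
second series, which the shift `s ↦ s + 1` turns into a multiple of the first. -/
theorem finiteTheta_step_left {p w : ℂ} (hp : p ≠ 0) (hw : w ≠ 0) (hp1 : ‖p‖ < 1) (x y : ℤ) :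
    (1 - p ^ (2 * (x + y))) * finiteTheta p w x y =
      (1 - w * p ^ (2 * x - 1)) * finiteTheta p w (x - 1) y := by
  have hQ : p ^ 2 ≠ 0 := pow_ne_zero 2 hp
  have hQ1 : ‖p ^ 2‖ < 1 := by rw [norm_pow]; exact pow_lt_one₀ (norm_nonneg p) hp1 two_ne_zero
  have e (n : ℤ) : (p ^ 2) ^ n = p ^ (2 * n) := by rw [zpow_mul]; norm_cast
  have key : (1 - p ^ (2 * (x + y))) * finiteTheta p w x y =
      finiteTheta p w (x - 1) y + p ^ (2 * x) * finiteTheta p (w * (p ^ 2)⁻¹) x (y - 1) := by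
    simp only [finiteTheta]
    rw [← tsum_mul_left, ← tsum_mul_left, ← (summable_mul_qFactInv _ _ _ _).tsum_add
      ((summable_mul_qFactInv _ _ _ _).mul_left _)]
    refine tsum_congr fun s => ?_
    have h := mul_qFactInv_mul_qFactInv hQ hQ1 (x - s) (y + s)
    have h2 : (p ^ 2) ^ (x - s) = p ^ (2 * x) * ((p ^ 2)⁻¹) ^ s := by
      rw [zpow_sub₀ hQ, e x, inv_zpow, div_eq_mul_inv]
    rw [show x - s + (y + s) = x + y by ring, e (x + y), h2,
      show x - s - 1 = x - 1 - s by ring, show y + s - 1 = y - 1 + s by ring] at h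
    rw [mul_zpow]
    linear_combination ((-1) ^ s * w ^ s * p ^ (s ^ 2)) * h
  rw [key, finiteTheta_shift hp (mul_ne_zero hw (inv_ne_zero hQ)) x, sub_add_cancel,
    inv_mul_cancel_right₀ hQ, zpow_sub_one₀ hp]
  field_simp
  ring

theorem finiteTheta_step_right {p w : ℂ} (hp : p ≠ 0) (hw : w ≠ 0) (hp1 : ‖p‖ < 1) (x y : ℤ) :
    (1 - p ^ (2 * (x + y))) * finiteTheta p w x y =
      (1 - w⁻¹ * p ^ (2 * y - 1)) * finiteTheta p w x (y - 1) := by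
  rw [finiteTheta_reflect, finiteTheta_reflect p w x, add_comm x,
    finiteTheta_step_left hp (inv_ne_zero hw) hp1]

theorem finiteTheta_zero (p w : ℂ) : finiteTheta p w 0 0 = 1 := by
  simp only [finiteTheta]
  rw [tsum_eq_single 0]
  · simp
  · intro s hs
    rcases lt_or_gt_of_ne hs with h | h
    · rw [qFactInv_of_neg _ (n := _ + s) (by omega), mul_zero]
    · rw [qFactInv_of_neg _ (n := _ - s) (by omega), mul_zero, zero_mul]

/-- The finite form of Jacobi's triple product. -/
theorem finiteTheta_eq_prod {p w : ℂ} (hp : p ≠ 0) (hw : w ≠ 0) (hp1 : ‖p‖ < 1) (n : ℕ) :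
    qPoch (p ^ 2) (p ^ 2) (2 * n) * finiteTheta p w n n =
      qPoch (p * w) (p ^ 2) n * qPoch (p / w) (p ^ 2) n := by
  induction n with
  | zero => simp [finiteTheta_zero]
  | succ n ih =>
    have h1 := finiteTheta_step_left hp hw hp1 (n + 1 : ℕ) (n + 1 : ℕ)
    have h2 := finiteTheta_step_right hp hw hp1 ((n + 1 : ℕ) - 1) (n + 1 : ℕ)
    rw [show ((n + 1 : ℕ) : ℤ) - 1 = n by push_cast; ring] at h1 h2
    rw [show 2 * (((n + 1 : ℕ) : ℤ) + (n + 1 : ℕ)) = ((2 * (2 * n + 2) : ℕ) : ℤ) by push_cast; ring,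
      show 2 * ((n + 1 : ℕ) : ℤ) - 1 = ((2 * n + 1 : ℕ) : ℤ) by push_cast; ring, zpow_natCast,
      zpow_natCast] at h1
    rw [show 2 * ((n : ℤ) + (n + 1 : ℕ)) = ((2 * (2 * n + 1) : ℕ) : ℤ) by push_cast; ring,
      show 2 * ((n + 1 : ℕ) : ℤ) - 1 = ((2 * n + 1 : ℕ) : ℤ) by push_cast; ring, zpow_natCast,
      zpow_natCast] at h2
    rw [show 2 * (n + 1) = 2 * n + 1 + 1 by ring, qPoch_succ, qPoch_succ, qPoch_succ, qPoch_succ]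
    have e1 : p ^ 2 * (p ^ 2) ^ (2 * n + 1) = p ^ (2 * (2 * n + 2)) := by
      rw [← pow_mul, ← pow_add]; congr 1; ring
    have e2 : p ^ 2 * (p ^ 2) ^ (2 * n) = p ^ (2 * (2 * n + 1)) := by
      rw [← pow_mul, ← pow_add]; congr 1; ring
    have e3 : p * w * (p ^ 2) ^ n = w * p ^ (2 * n + 1) := by rw [← pow_mul]; ring
    have e4 : p / w * (p ^ 2) ^ n = w⁻¹ * p ^ (2 * n + 1) := by rw [← pow_mul]; ring
    rw [e1, e2, e3, e4]
    linear_combination qPoch (p ^ 2) (p ^ 2) (2 * n) * (1 - p ^ (2 * (2 * n + 1))) * h1 +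
      qPoch (p ^ 2) (p ^ 2) (2 * n) * (1 - w * p ^ (2 * n + 1)) * h2 +
      (1 - w * p ^ (2 * n + 1)) * (1 - w⁻¹ * p ^ (2 * n + 1)) * ih

/-! ### Limits and bounds -/

open Filter Topology

theorem tendsto_qPoch (a : ℂ) {q : ℂ} (hq : ‖q‖ < 1) :
    Tendsto (qPoch a q) atTop (𝓝 (qPochInf a q)) :=
  (multipliable_qPochInf a q hq).hasProd.tendsto_prod_nat

theorem exists_norm_qPoch_le (a : ℂ) {q : ℂ} (hq : ‖q‖ < 1) : ∃ C, ∀ n, ‖qPoch a q n‖ ≤ C := by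
  obtain ⟨C, hC⟩ := (Metric.isBounded_range_of_tendsto _ (tendsto_qPoch a hq)).exists_norm_le
  exact ⟨C, fun n => hC _ ⟨n, rfl⟩⟩

theorem qPochInf_self_ne_zero {q : ℂ} (hq : ‖q‖ < 1) : qPochInf q q ≠ 0 := by
  have h : ∏' j : ℕ, (1 + -q ^ (j + 1)) ≠ 0 := by
    refine tprod_one_add_ne_zero_of_summable (fun j => ?_) ?_
    · rw [← sub_eq_add_neg]; exact one_sub_pow_ne_zero hq j.succ_ne_zero
    · simp only [norm_neg, norm_pow]
      exact (summable_nat_add_iff 1).mpr (summable_geometric_of_lt_one (norm_nonneg q) hq)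
  simpa only [qPochInf, ← pow_succ', sub_eq_add_neg] using h

theorem tendsto_inv_qPoch_self {q : ℂ} (hq : ‖q‖ < 1) :
    Tendsto (fun n => (qPoch q q n)⁻¹) atTop (𝓝 (qPochInf q q)⁻¹) :=
  (tendsto_qPoch q hq).inv₀ (qPochInf_self_ne_zero hq)

theorem exists_norm_qFactInv_le {q : ℂ} (hq : ‖q‖ < 1) :
    ∃ C, 0 ≤ C ∧ ∀ n, ‖qFactInv q n‖ ≤ C := by
  obtain ⟨C, hC⟩ :=
    (Metric.isBounded_range_of_tendsto _ (tendsto_inv_qPoch_self hq)).exists_norm_le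
  have h0 : 0 ≤ C := (norm_nonneg _).trans (hC _ ⟨0, rfl⟩)
  refine ⟨C, h0, fun n => ?_⟩
  rcases lt_or_ge n 0 with h | h
  · rwa [qFactInv_of_neg q h, norm_zero]
  · obtain ⟨m, rfl⟩ := Int.eq_ofNat_of_zero_le h
    rw [qFactInv_natCast]
    exact hC _ ⟨m, rfl⟩

theorem tendsto_qFactInv_add {q : ℂ} (hq : ‖q‖ < 1) (c : ℤ) :
    Tendsto (fun N : ℕ => qFactInv q (N + c)) atTop (𝓝 (qPochInf q q)⁻¹) := by
  have h1 : Tendsto (fun N : ℕ => ((N : ℤ) + c).toNat) atTop atTop := by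
    refine tendsto_atTop.mpr fun M => ?_
    filter_upwards [eventually_ge_atTop (M + c.natAbs)] with N hN
    omega
  refine ((tendsto_inv_qPoch_self hq).comp h1).congr' ?_
  filter_upwards [eventually_ge_atTop c.natAbs] with N hN
  rw [qFactInv, if_pos (by omega), Function.comp_apply]

/-- Termwise passage to the limit in the bilateral sums, by dominated convergence. -/
theorem tendsto_tsum_mul_qFactInv {q : ℂ} (hq : ‖q‖ < 1) {f : ℤ → ℂ} (hf : Summable (‖f ·‖))
    (a c : ℤ) :
    Tendsto (fun N : ℕ => ∑' s : ℤ, f s * qFactInv q (N - c * s) * qFactInv q (N + a + c * s))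
      atTop (𝓝 ((∑' s, f s) * (qPochInf q q)⁻¹ * (qPochInf q q)⁻¹)) := by
  obtain ⟨C, hC0, hC⟩ := exists_norm_qFactInv_le hq
  rw [← tsum_mul_right, ← tsum_mul_right]
  refine tendsto_tsum_of_dominated_convergence (bound := fun s => ‖f s‖ * C * C)
    ((hf.mul_right C).mul_right C) (fun s => ?_) (Eventually.of_forall fun N s => ?_)
  · refine (tendsto_const_nhds.mul ?_).mul ?_
    · simpa only [sub_eq_add_neg] using tendsto_qFactInv_add hq (-(c * s))
    · simpa only [add_assoc] using tendsto_qFactInv_add hq (a + c * s)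
  · rw [norm_mul, norm_mul]
    gcongr <;> exact hC _

theorem exists_norm_baileySum_le {q : ℂ} (hq : ‖q‖ < 1) {α : ℤ → ℂ} (hα : Summable (‖α ·‖)) :
    ∃ C, 0 ≤ C ∧ ∀ x y, ‖baileySum q α x y‖ ≤ C := by
  obtain ⟨C, hC0, hC⟩ := exists_norm_qFactInv_le hq
  refine ⟨∑' s, ‖α s‖ * C * C, tsum_nonneg fun s => by positivity, fun x y => ?_⟩
  refine tsum_of_norm_bounded ((hα.mul_right C).mul_right C).hasSum fun s => ?_
  rw [norm_mul, norm_mul]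
  gcongr <;> exact hC _

theorem summable_pow_mul_pow_self (w : ℂ) {p : ℂ} (hp1 : ‖p‖ < 1) :
    Summable fun n : ℕ => ‖w ^ n * p ^ (n ^ 2)‖ := by
  have ht : Tendsto (fun n : ℕ => ‖w‖ * ‖p‖ ^ n) atTop (𝓝 (‖w‖ * 0)) :=
    (tendsto_pow_atTop_nhds_zero_of_lt_one (norm_nonneg p) hp1).const_mul _
  rw [mul_zero] at ht
  refine Summable.of_norm_bounded_eventually_nat
    (summable_geometric_of_lt_one (r := 1 / 2) (by norm_num) (by norm_num)) ?_
  filter_upwards [ht.eventually_le_const (show (0 : ℝ) < 1 / 2 by norm_num)] with n hn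
  rw [norm_norm, norm_mul, norm_pow, norm_pow, pow_two, pow_mul, ← mul_pow]
  exact pow_le_pow_left₀ (by positivity) hn n

theorem summable_theta {p : ℂ} (hp1 : ‖p‖ < 1) (w : ℂ) :
    Summable fun s : ℤ => ‖(-1) ^ s * w ^ s * p ^ (s ^ 2)‖ := by
  refine Summable.of_nat_of_neg ?_ ?_
  · refine (summable_pow_mul_pow_self w hp1).congr fun n => ?_
    rw [mul_assoc, norm_mul ((-1) ^ (n : ℤ)), norm_zpow, norm_neg, norm_one, one_zpow, one_mul]
    norm_cast
  · refine (summable_pow_mul_pow_self w⁻¹ hp1).congr fun n => ?_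
    rw [mul_assoc, norm_mul ((-1) ^ (-(n : ℤ))), norm_zpow, norm_neg, norm_one, one_zpow, one_mul,
      zpow_neg, neg_sq, inv_pow]
    norm_cast

/-- Jacobi's triple product identity. -/
theorem jacobi_triple_product {p w : ℂ} (hp : p ≠ 0) (hw : w ≠ 0) (hp1 : ‖p‖ < 1) :
    ∑' s : ℤ, (-1) ^ s * w ^ s * p ^ (s ^ 2) =
      qPochInf₃ (p ^ 2) (p * w) (p / w) (p ^ 2) := by
  have hQ1 : ‖p ^ 2‖ < 1 := by rw [norm_pow]; exact pow_lt_one₀ (norm_nonneg p) hp1 two_ne_zero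
  have h1 := tendsto_tsum_mul_qFactInv hQ1 (summable_theta hp1 w) 0 1
  simp only [add_zero, one_mul] at h1
  have h2 : Tendsto (fun n : ℕ => 2 * n) atTop atTop :=
    tendsto_id.const_mul_atTop' (by norm_num)
  have h3 := ((tendsto_qPoch (p ^ 2) hQ1).comp h2).mul h1
  have h4 := (tendsto_qPoch (p * w) hQ1).mul (tendsto_qPoch (p / w) hQ1)
  have h5 := tendsto_nhds_unique h3 (h4.congr fun n => (finiteTheta_eq_prod hp hw hp1 n).symm)
  have hne := qPochInf_self_ne_zero hQ1
  rw [qPochInf₃, mul_assoc, ← h5]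
  field_simp

/-! ### The double series -/

/-- Exponents at least `m + k` and bounded coefficients suffice for convergence, by comparison with
a product of two geometric series. -/
theorem summable_double_of_bounded {q : ℂ} (hq : ‖q‖ < 1) {e : ℕ × ℕ → ℕ} {h : ℕ × ℕ → ℂ} {C : ℝ}
    (he : ∀ x, x.1 + x.2 ≤ e x) (hh : ∀ x, ‖h x‖ ≤ C) : Summable fun x => q ^ e x * h x := by
  have hg := summable_geometric_of_lt_one (norm_nonneg q) hq
  refine Summable.of_norm_bounded ((hg.mul_of_nonneg hg (fun n => by positivity)
    (fun n => by positivity)).mul_right C) fun x => ?_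
  rw [norm_mul, norm_pow, ← pow_add]
  exact mul_le_mul (pow_le_pow_of_le_one (norm_nonneg q) hq.le (he x)) (hh x) (norm_nonneg _)
    (by positivity)

theorem zpow_quadratic_mul_thetaCoeff {q : ℂ} (h0 : q ≠ 0) (c d b s : ℤ) :
    q ^ (c * s ^ 2 + d * s) * thetaCoeff q b s =
      (-1) ^ s * (q ^ (d + b)) ^ s * (q ^ (c + 2)) ^ (s ^ 2) := by
  rw [thetaCoeff, mul_left_comm, ← zpow_add₀ h0, mul_assoc, ← zpow_mul, ← zpow_mul,
    ← zpow_add₀ h0]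
  ring_nf

theorem summable_zpow_quadratic_mul_thetaCoeff {q : ℂ} (h0 : q ≠ 0) (hq : ‖q‖ < 1) (c : ℕ)
    (d b : ℤ) : Summable fun s : ℤ => ‖q ^ ((c : ℤ) * s ^ 2 + d * s) * thetaCoeff q b s‖ := by
  simp only [zpow_quadratic_mul_thetaCoeff h0]
  refine summable_theta ?_ _
  rw [norm_zpow]
  exact zpow_lt_one₀ (norm_pos_iff.mpr h0) hq (by omega)

theorem summable_zpow_quadratic {q : ℂ} (h0 : q ≠ 0) (hq : ‖q‖ < 1) (a : ℤ) :
    Summable fun n : ℤ => ‖q ^ (n ^ 2 + a * n)‖ := by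
  refine (summable_theta hq (q ^ a)).congr fun n => ?_
  rw [mul_assoc, norm_mul ((-1) ^ n), norm_zpow (-1), norm_neg, norm_one, one_zpow, one_mul,
    add_comm, zpow_add₀ h0, zpow_mul]

/-- The limiting case of Bailey's lemma: the index in `1 / (q)_{n-k}` is sent to infinity. -/
theorem tsum_zpow_mul_baileySum {q : ℂ} (h0 : q ≠ 0) (hq : ‖q‖ < 1) {α : ℤ → ℂ} (a : ℤ)
    (hα : Summable (‖α ·‖)) (hα' : Summable fun s => ‖q ^ (4 * s ^ 2 + 2 * a * s) * α s‖) :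
    ∑' n : ℤ, q ^ (n ^ 2 + a * n) * baileySum q α n (n + a) =
      (∑' s, q ^ (4 * s ^ 2 + 2 * a * s) * α s) / qPochInf q q := by
  obtain ⟨C, hC0, hC⟩ := exists_norm_qFactInv_le hq
  obtain ⟨K, hK0, hK⟩ := exists_norm_baileySum_le hq hα
  have h1 : Tendsto (fun N : ℕ => ∑' n : ℤ, q ^ (n ^ 2 + a * n) * qFactInv q (N - n) *
      baileySum q α n (n + a)) atTop
      (𝓝 (∑' n : ℤ, q ^ (n ^ 2 + a * n) * (qPochInf q q)⁻¹ * baileySum q α n (n + a))) := by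
    refine tendsto_tsum_of_dominated_convergence
      (((summable_zpow_quadratic h0 hq a).mul_right C).mul_right K) (fun n => ?_)
      (Eventually.of_forall fun N n => ?_)
    · refine (tendsto_const_nhds.mul ?_).mul tendsto_const_nhds
      simpa only [sub_eq_add_neg] using tendsto_qFactInv_add hq (-n)
    · rw [norm_mul, norm_mul]
      gcongr
      · exact hC _
      · exact hK _ _
  -- For finite `N` the left side is given by Bailey's lemma; one of the two factors `1 / (q)_∞` in
  -- the limit of the right side cancels.
  have h2 := tendsto_nhds_unique (h1.congr fun N : ℕ => tsum_mul_baileySum h0 hq α a N)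
    (tendsto_tsum_mul_qFactInv hq hα' a 2)
  have hne := qPochInf_self_ne_zero hq
  rw [div_eq_mul_inv]
  refine mul_right_cancel₀ (inv_ne_zero hne) ?_
  rw [← h2, ← tsum_mul_right]
  exact tsum_congr fun n => by ring

theorem baileySum_thetaCoeff_of_neg (q : ℂ) {a : ℕ} (ha : a ≤ 2) (b : ℤ) {k : ℤ} (hk : k < 0) :
    baileySum q (thetaCoeff q b) k (k + a) = 0 := by
  rw [baileySum]
  convert tsum_zero with s
  rcases le_or_gt 0 s with h | h
  · rw [qFactInv_of_neg q (n := k - 2 * s) (by omega), mul_zero, zero_mul]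
  · rw [qFactInv_of_neg q (n := k + a + 2 * s) (by omega), mul_zero]

/-- The general double series of Rogers–Ramanujan type behind all ten identities: two applications
of Bailey's lemma followed by the triple product. -/
theorem hasSum_altGauss {q : ℂ} (h0 : q ≠ 0) (hq : ‖q‖ < 1) {a : ℕ} (ha : a ≤ 2) (b : ℤ) {i j : ℕ}
    (hi : (i : ℤ) = 10 - b - 4 * a) (hj : i + j = 20) :
    HasSum (fun x : ℕ × ℕ => q ^ (x.2 ^ 2 + a * x.2 + (x.1 + x.2) ^ 2 + a * (x.1 + x.2)) *
        (altGauss q (2 * x.2 + a) b x.2 / (qPoch q q x.1 * qPoch q q (2 * x.2 + a))))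
      (qPochInf₃ (q ^ 20) (q ^ i) (q ^ j) (q ^ 20) / qPochInf q q) := by
  set α := thetaCoeff q b with hαdef
  -- In terms of `n = m + k` the series is a sum over the integer pairs `(n, k)`, where it can be
  -- summed first over `k` and then over `n`.
  set g : ℤ × ℤ → ℂ := fun x => q ^ (x.1 ^ 2 + a * x.1) *
    (q ^ (x.2 ^ 2 + a * x.2) * qFactInv q (x.1 - x.2) * baileySum q α x.2 (x.2 + a)) with hg
  set ι : ℕ × ℕ → ℤ × ℤ := fun x => (x.1 + x.2, x.2) with hι
  have hιinj : Function.Injective ι := by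
    rintro ⟨m, k⟩ ⟨m', k'⟩ h
    simp only [hι, Prod.mk.injEq] at h ⊢
    omega
  have hsupp : ∀ x, x ∉ Set.range ι → g x = 0 := by
    rintro ⟨n, k⟩ hx
    by_contra hne
    have h1 := nonneg_of_qFactInv_ne_zero
      (right_ne_zero_of_mul (left_ne_zero_of_mul (right_ne_zero_of_mul hne)))
    have h2 : 0 ≤ k := by
      by_contra! hk
      exact (right_ne_zero_of_mul (right_ne_zero_of_mul hne)) (baileySum_thetaCoeff_of_neg q ha b hk)
    refine hx ⟨((n - k).toNat, k.toNat), ?_⟩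
    simp only [hι, Prod.mk.injEq] at h1 ⊢
    omega
  have hα : Summable (‖α ·‖) := by
    simpa using summable_zpow_quadratic_mul_thetaCoeff h0 hq 0 0 b
  have hα1 : Summable fun s => ‖q ^ (4 * s ^ 2 + 2 * (a : ℤ) * s) * α s‖ := by
    simpa using summable_zpow_quadratic_mul_thetaCoeff h0 hq 4 (2 * a) b
  have hα2 (s : ℤ) : q ^ (4 * s ^ 2 + 2 * (a : ℤ) * s) * (q ^ (4 * s ^ 2 + 2 * (a : ℤ) * s) * α s) =
      q ^ (8 * s ^ 2 + (4 * a) * s) * α s := by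
    rw [← mul_assoc, ← zpow_add₀ h0]; ring_nf
  obtain ⟨C, hC0, hC⟩ := exists_norm_qFactInv_le hq
  obtain ⟨K, hK0, hK⟩ := exists_norm_baileySum_le hq hα
  have hgι (x : ℕ × ℕ) : g (ι x) = q ^ (x.2 ^ 2 + a * x.2 + (x.1 + x.2) ^ 2 + a * (x.1 + x.2)) *
      (baileySum q α x.2 (x.2 + a) * qFactInv q x.1) := by
    simp only [hg, hι, add_sub_cancel_right]
    rw [← mul_assoc, ← mul_assoc, ← zpow_add₀ h0, mul_assoc, mul_comm (qFactInv q _),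
      ← zpow_natCast q]
    congr 2
    push_cast
    ring
  have hsum : Summable g := by
    refine (hιinj.summable_iff hsupp).mp ?_
    refine (summable_double_of_bounded hq (C := K * C)
      (e := fun x => x.2 ^ 2 + a * x.2 + (x.1 + x.2) ^ 2 + a * (x.1 + x.2))
      (h := fun x => baileySum q α x.2 (x.2 + a) * qFactInv q x.1) (fun x => ?_)
      (fun x => ?_)).congr fun x => (hgι x).symm
    · have := Nat.le_self_pow two_ne_zero (x.1 + x.2)
      omega
    · rw [norm_mul]
      gcongr
      · exact hK _ _
      · exact hC _
  have htsum : ∑' x, g x = qPochInf₃ (q ^ 20) (q ^ i) (q ^ j) (q ^ 20) / qPochInf q q := by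
    rw [hsum.tsum_prod]
    simp only [hg, tsum_mul_left]
    simp only [tsum_mul_baileySum h0 hq]
    rw [tsum_zpow_mul_baileySum h0 hq a hα1]
    · congr 1
      rw [tsum_congr hα2]
      simp only [hαdef, zpow_quadratic_mul_thetaCoeff h0]
      have hp1 : ‖q ^ 10‖ < 1 := by rw [norm_pow]; exact pow_lt_one₀ (norm_nonneg q) hq (by norm_num)
      have hJ := jacobi_triple_product (pow_ne_zero 10 h0)
        (zpow_ne_zero (4 * a + b) h0) hp1
      have e0 : q ^ ((8 : ℤ) + 2) = q ^ 10 := by norm_cast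
      have e1 : q ^ 10 * q ^ (4 * (a : ℤ) + b) = q ^ j := by
        rw [← zpow_natCast, ← zpow_natCast, ← zpow_add₀ h0]; congr 1; push_cast; omega
      have e2 : q ^ 10 / q ^ (4 * (a : ℤ) + b) = q ^ i := by
        rw [← zpow_natCast, ← zpow_natCast, ← zpow_sub₀ h0]; congr 1; push_cast; omega
      rw [e0, hJ, e1, e2, ← pow_mul, qPochInf₃, qPochInf₃]
      ring
    · simp only [hα2]
      exact summable_zpow_quadratic_mul_thetaCoeff h0 hq 8 (4 * a) b
  rw [← htsum]
  refine ((hιinj.hasSum_iff hsupp).mpr hsum.hasSum).congr_fun fun x => ?_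
  have hne := qPoch_self_ne_zero hq (2 * x.2 + a)
  have hN : ((2 * x.2 + a : ℕ) : ℤ) - x.2 = x.2 + a := by push_cast; ring
  rw [Function.comp_apply, hgι, altGauss, hN, ← hαdef, qFactInv_natCast]
  field_simp

/-- Where two series are evaluated together, this gives the convergence of the first of them; that
of the second follows by subtracting from the combined series. -/
theorem summable_double_qPoch_neg_one {q : ℂ} (hq : ‖q‖ < 1) {e : ℕ × ℕ → ℕ}
    (he : ∀ x, x.1 + x.2 ≤ e x) {u : ℕ → ℂ} (hu : ∀ k, ‖u k‖ ≤ 2) (n : ℕ → ℕ) :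
    Summable fun x : ℕ × ℕ => q ^ e x *
      (u x.2 * qPoch (-1) (q ^ 2) x.2 * (qPoch q q x.1)⁻¹ * (qPoch q q (n x.2))⁻¹) := by
  have hq2 : ‖q ^ 2‖ < 1 := by rw [norm_pow]; exact pow_lt_one₀ (norm_nonneg q) hq two_ne_zero
  obtain ⟨C, hC0, hC⟩ := exists_norm_qFactInv_le hq
  obtain ⟨K, hK⟩ := exists_norm_qPoch_le (-1) hq2
  have hK0 : 0 ≤ K := (norm_nonneg _).trans (hK 0)
  refine summable_double_of_bounded hq (C := 2 * K * C * C) he fun x => ?_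
  rw [← qFactInv_natCast, ← qFactInv_natCast, norm_mul, norm_mul, norm_mul]
  gcongr
  · exact hu _
  · exact hK _
  · exact hC _
  · exact hC _

theorem hasSum_of_eq_zero {f : ℕ × ℕ → ℂ} {c : ℂ} (h0 : f (0, 0) = c)
    (h : ∀ m k, (m + k) ^ 2 ≠ 0 → f (m, k) = 0) : HasSum f c := by
  rw [← h0]
  refine hasSum_single _ ?_
  rintro ⟨m, k⟩ hx
  refine h m k (pow_ne_zero 2 fun h' => hx ?_)
  rw [Prod.mk.injEq]
  omega

theorem qPochInf_zero_left (q : ℂ) : qPochInf 0 q = 1 := by simp [qPochInf]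

theorem qPoch_zero_left (q : ℂ) (n : ℕ) : qPoch 0 q n = 1 := by simp [qPoch]

theorem qPoch_double_succ_succ (q : ℂ) (k : ℕ) :
    qPoch q q (2 * k + 2) = qPoch q q (2 * k + 1) * ((1 - q ^ (k + 1)) * (1 + q ^ (k + 1))) := by
  rw [qPoch_succ]
  ring

theorem mainTheorem5 (q : ℂ) (hq : ‖q‖ < 1) :
    HasSum (fun ((m, k) : ℕ × ℕ) =>
        q ^ (k ^ 2 + (m + k) ^ 2 + 2 * (m + 2 * k)) / (qPoch q q m * qPoch q q (2 * k + 1)) *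
          (qPoch (-q ^ 2) (q ^ 2) k / (1 + q ^ (k + 1))))
      (qPochInf₃ (q ^ 20) (q ^ 1) (q ^ 19) (q ^ 20) / qPochInf q q) ∧
    HasSum (fun ((m, k) : ℕ × ℕ) =>
        q ^ (k ^ 2 + (m + k) ^ 2 + 2 * (m + 2 * k)) * qPoch (-q) (q ^ 2) k /
          (qPoch q q m * qPoch q q (2 * k + 1)))
      (qPochInf₃ (q ^ 20) (q ^ 2) (q ^ 18) (q ^ 20) / qPochInf q q) ∧
    (∃ S T : ℂ,
      HasSum (fun ((m, k) : ℕ × ℕ) =>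
        q ^ (k ^ 2 + (m + k) ^ 2 + 2 * (m + 2 * k)) * (1 + q ^ (k + 1)) * qPoch (-1) (q ^ 2) k /
          (2 * qPoch q q m * qPoch q q (2 * k + 1))) S ∧
      HasSum (fun ((m, k) : ℕ × ℕ) =>
        q ^ (k ^ 2 + (m + k) ^ 2 + 2 * (m + 2 * k) + k) * (1 + q ^ 2) * qPoch (-1) (q ^ 2) k /
          (2 * qPoch q q m * qPoch q q (2 * k + 1) * (1 + q ^ (k + 1)))) T ∧
      S + T = qPochInf₃ (q ^ 20) (q ^ 3) (q ^ 17) (q ^ 20) / qPochInf q q) ∧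
    HasSum (fun ((m, k) : ℕ × ℕ) =>
        q ^ (k ^ 2 + (m + k) ^ 2 + (m + 3 * k)) / (qPoch q q m * qPoch q q (2 * k + 1)) *
          qPoch (-q) (q ^ 2) k)
      (qPochInf₃ (q ^ 20) (q ^ 4) (q ^ 16) (q ^ 20) / qPochInf q q) ∧
    HasSum (fun ((m, k) : ℕ × ℕ) =>
        q ^ (k ^ 2 + (m + k) ^ 2 + (m + 2 * k)) / (qPoch q q m * qPoch q q (2 * k + 1)) *
          qPoch (-q ^ 2) (q ^ 2) k)
      (qPochInf₃ (q ^ 20) (q ^ 5) (q ^ 15) (q ^ 20) / qPochInf q q) ∧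
    HasSum (fun ((m, k) : ℕ × ℕ) =>
        q ^ (k ^ 2 + (m + k) ^ 2 + (m + 2 * k)) / (qPoch q q m * qPoch q q (2 * k + 1)) *
          qPoch (-q) (q ^ 2) k)
      (qPochInf₃ (q ^ 20) (q ^ 6) (q ^ 14) (q ^ 20) / qPochInf q q) ∧
    (∃ S T : ℂ,
      HasSum (fun ((m, k) : ℕ × ℕ) =>
        q ^ (k ^ 2 + (m + k) ^ 2 + (m + 2 * k)) / (qPoch q q m * qPoch q q (2 * k)) *
          (qPoch (-1) (q ^ 2) k / 2)) S ∧
      HasSum (fun ((m, k) : ℕ × ℕ) =>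
        q ^ (k ^ 2 + (m + k) ^ 2 + (m + 3 * k)) / (qPoch q q m * qPoch q q (2 * k + 1)) *
          (qPoch (-1) (q ^ 2) k / 2)) T ∧
      S + (1 + q) * T = qPochInf₃ (q ^ 20) (q ^ 7) (q ^ 13) (q ^ 20) / qPochInf q q) ∧
    HasSum (fun ((m, k) : ℕ × ℕ) =>
        q ^ (k ^ 2 + (m + k) ^ 2 + k) / (qPoch q q m * qPoch q q (2 * k)) *
          qPoch (-(1 / q)) (q ^ 2) k)
      (qPochInf₃ (q ^ 20) (q ^ 8) (q ^ 12) (q ^ 20) / qPochInf q q) ∧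
    HasSum (fun ((m, k) : ℕ × ℕ) =>
        q ^ (k ^ 2 + (m + k) ^ 2) / (qPoch q q m * qPoch q q (2 * k)) *
          ((1 + q ^ k) / 2) * qPoch (-1) (q ^ 2) k)
      (qPochInf₃ (q ^ 20) (q ^ 9) (q ^ 11) (q ^ 20) / qPochInf q q) ∧
    HasSum (fun ((m, k) : ℕ × ℕ) =>
        q ^ (k ^ 2 + (m + k) ^ 2) / (qPoch q q m * qPoch q q (2 * k)) *
          qPoch (-q) (q ^ 2) k)
      (qPochInf₃ (q ^ 20) (q ^ 10) (q ^ 10) (q ^ 20) / qPochInf q q) := by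
  rcases eq_or_ne q 0 with rfl | h0
  -- For `q = 0` only the term `m = k = 0` survives, as every other term carries a positive power
  -- of `q`. In particular the value of `-(1 / q)` plays no role, the product being empty for `k = 0`.
  · have hR (i j : ℕ) (hi : i ≠ 0) (hj : j ≠ 0) :
        qPochInf₃ ((0 : ℂ) ^ 20) (0 ^ i) (0 ^ j) (0 ^ 20) / qPochInf 0 0 = 1 := by
      simp [qPochInf₃, qPochInf_zero_left, zero_pow hi, zero_pow hj]
    refine ⟨?_, ?_, ⟨1 / 2, 1 / 2, ?_, ?_, ?_⟩, ?_, ?_, ?_, ⟨1 / 2, 1 / 2, ?_, ?_, ?_⟩, ?_, ?_, ?_⟩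
    all_goals try rw [hR _ _ (by norm_num) (by norm_num)]
    case refine_5 | refine_11 => norm_num
    all_goals
      refine hasSum_of_eq_zero (by norm_num [qPoch_zero_left]) fun m k hmk => ?_
      dsimp only
      rw [zero_pow (by omega)]
      simp
  have hne := qPoch_self_ne_zero hq
  have hm (k : ℕ) : 1 - q ^ (k + 1) ≠ 0 := one_sub_pow_ne_zero hq k.succ_ne_zero
  have hp (k : ℕ) : 1 + q ^ (k + 1) ≠ 0 := one_add_pow_ne_zero hq k.succ_ne_zero
  have hu (k : ℕ) : ‖1 + q ^ (k + 1)‖ ≤ 2 := by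
    refine (norm_add_le _ _).trans ?_
    rw [norm_one, norm_pow]
    linarith [pow_le_one₀ (n := k + 1) (norm_nonneg q) hq.le]
  have hle (m k : ℕ) : m + k ≤ (m + k) ^ 2 := Nat.le_self_pow two_ne_zero _
  refine ⟨?_, ?_, ?_, ?_, ?_, ?_, ?_, ?_, ?_, ?_⟩
  · refine (hasSum_altGauss h0 hq (a := 2) le_rfl 1 (by norm_num) rfl).congr_fun ?_
    rintro ⟨m, k⟩
    have h1 := hne m
    have h2 := hne (2 * k + 1)
    have h3 := hm k
    have h4 := hp k
    dsimp only
    rw [altGauss_offset_one h0 hq, qPoch_double_succ_succ]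
    field_simp
    ring
  · refine (hasSum_altGauss h0 hq (a := 2) le_rfl 0 (by norm_num) rfl).congr_fun ?_
    rintro ⟨m, k⟩
    have h1 := hne m
    have h2 := hne (2 * k + 1)
    have h3 := hm k
    have h4 := hp k
    dsimp only
    rw [altGauss_offset_zero h0 hq, qPoch_double_succ_succ, 
      show 1 - q ^ (2 * k + 2) = (1 - q ^ (k + 1)) * (1 + q ^ (k + 1)) by ring]
    field_simp
    ring
  · have H := hasSum_altGauss h0 hq (a := 2) le_rfl (-1) (i := 3) (j := 17) (by norm_num) rfl
    have hS : Summable (fun ((m, k) : ℕ × ℕ) =>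
        q ^ (k ^ 2 + (m + k) ^ 2 + 2 * (m + 2 * k)) * (1 + q ^ (k + 1)) * qPoch (-1) (q ^ 2) k /
          (2 * qPoch q q m * qPoch q q (2 * k + 1))) := by
      refine ((summable_double_qPoch_neg_one hq
        (e := fun x => x.2 ^ 2 + (x.1 + x.2) ^ 2 + 2 * (x.1 + 2 * x.2)) (fun x => ?_)
        (u := fun k => 1 + q ^ (k + 1)) hu fun k => 2 * k + 1).mul_left (1 / 2)).congr ?_
      · have := hle x.1 x.2
        omega
      · rintro ⟨m, k⟩
        dsimp only
        field_simp
    -- The second series is the termwise difference of the combined series and the first one.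
    refine ⟨_, _, hS.hasSum, (H.sub hS.hasSum).congr_fun ?_, add_sub_cancel _ _⟩
    rintro ⟨m, k⟩
    have h1 := hne m
    have h2 := hne (2 * k + 1)
    have h3 := hm k
    have h4 := hp k
    dsimp only
    rw [altGauss_offset_neg_one h0 hq, qPoch_double_succ_succ]
    field_simp
    ring
  · refine (hasSum_altGauss h0 hq (a := 1) (by norm_num) 2 (by norm_num) rfl).congr_fun ?_
    rintro ⟨m, k⟩
    dsimp only
    rw [(altGauss_odd_zero_two h0 hq k).2]
    ring
  · refine (hasSum_altGauss h0 hq (a := 1) (by norm_num) 1 (by norm_num) rfl).congr_fun ?_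
    rintro ⟨m, k⟩
    dsimp only
    rw [altGauss_odd_one h0 hq k]
    ring
  · refine (hasSum_altGauss h0 hq (a := 1) (by norm_num) 0 (by norm_num) rfl).congr_fun ?_
    rintro ⟨m, k⟩
    dsimp only
    rw [(altGauss_odd_zero_two h0 hq k).1]
    ring
  · have H := hasSum_altGauss h0 hq (a := 1) (by norm_num) (-1) (i := 7) (j := 13) (by norm_num) rfl
    have hS : Summable (fun ((m, k) : ℕ × ℕ) =>
        q ^ (k ^ 2 + (m + k) ^ 2 + (m + 2 * k)) / (qPoch q q m * qPoch q q (2 * k)) *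
          (qPoch (-1) (q ^ 2) k / 2)) := by
      refine ((summable_double_qPoch_neg_one hq
        (e := fun x => x.2 ^ 2 + (x.1 + x.2) ^ 2 + (x.1 + 2 * x.2)) (fun x => ?_)
        (u := fun _ => 1) (by simp) fun k => 2 * k).mul_left (1 / 2)).congr ?_
      · have := hle x.1 x.2
        omega
      · rintro ⟨m, k⟩
        dsimp only
        field_simp
    -- As `1 + q` does not vanish, the second series is again obtained by subtraction.
    have h1q : 1 + q ≠ 0 := by simpa using hp 0
    refine ⟨_, _, hS.hasSum, ((H.sub hS.hasSum).mul_left (1 + q)⁻¹).congr_fun ?_, ?_⟩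
    · rintro ⟨m, k⟩
      have h1 := hne m
      have h2 := hne (2 * k)
      have h3 : 1 - q ^ (2 * k + 1) ≠ 0 := hm (2 * k)
      dsimp only
      rw [altGauss_odd_neg_one h0 hq, qPoch_succ, ← pow_succ']
      field_simp
      ring
    · rw [mul_inv_cancel_left₀ h1q, add_sub_cancel]
  · refine (hasSum_altGauss h0 hq (a := 0) (by norm_num) 2 (by norm_num) rfl).congr_fun ?_
    rintro ⟨m, k⟩
    dsimp only
    rw [add_zero, altGauss_even_two h0 hq k]
    ring
  · refine (hasSum_altGauss h0 hq (a := 0) (by norm_num) 1 (by norm_num) rfl).congr_fun ?_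
    rintro ⟨m, k⟩
    dsimp only
    rw [add_zero, altGauss_even_one h0 hq k]
    ring
  · refine (hasSum_altGauss h0 hq (a := 0) (by norm_num) 0 (by norm_num) rfl).congr_fun ?_
    rintro ⟨m, k⟩
    dsimp only
    rw [add_zero, altGauss_even_zero h0 hq k]
    ring
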